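/- **Setting.** Let $\Omega\subset\mathbb{R}^d$ be a bounded smooth domain (bounded, connected, open, with $C^\infty$ boundary, $\Omega$ lying locally on one side of $\partial\Omega$). For each $n\ge 1$ let $\varphi_n\in C(\overline\Omega\times[0,\infty))\cap C^1(\Omega\times(0,\infty))$ satisfy $\varphi_n(x,s)>0$ for $x\in\Omega$, $s>0$, and suppose there are constants $p_n^-,p_n^+$ with $$0<p_n^--1\le\frac{s\,\partial_s\varphi_n(x,s)}{\varphi_n(x,s)}\le p_n^+-1\qquad(x\in\Omega,\ s>0),$$ such that $\lim_{n\to\infty}p_n^-=\infty$ and, for some constant $\mu>1$, $p_n^+\le\mu\,p_n^-$ for all $n$. Put $\Phi_n(x,s)=\int_0^s\varphi_n(x,t)\,dt$. Let $L^{\Phi_n(\cdot)}(\Omega)$ be the set of $u\in L^1(\Omega)$ with $\lim_{\lambda\to0}\int_\Omega\Phi_n(x,|\lambda u(x)|)\,dx=0$, and let $W^{1,\Phi_n(\cdot)}(\Omega)$ be the set of $u\in L^{\Phi_n(\cdot)}(\Omega)$ whose weak derivatives $\partial_1u,\dots,\partial_du$ exist and belong to $L^{\Phi_n(\cdot)}(\Omega)$.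 Define $E_n,E_\infty:L^1(\Omega)\to[0,\infty]$ by $$E_n(u)=\begin{cases}\displaystyle\int_\Omega\frac{\Phi_n(x,|\nabla u|)}{\varphi_n(x,1)}\,dx,&u\in W^{1,\Phi_n(\cdot)}(\Omega),\\ \infty,&\text{otherwise,}\end{cases}\qquad E_\infty(u)=\begin{cases}0,&u\in W^{1,\infty}(\Omega)\text{ and }\|\nabla u\|_{L^\infty(\Omega)}\le1,\\ \infty,&\text{otherwise.}\end{cases}$$ **Theorem.** $\Gamma(L^1(\Omega))\text{-}\lim_{n\to\infty}E_n=E_\infty$; that is, for every $u\in L^1(\Omega)$: (i) for every sequence $v_n\to u$ in $L^1(\Omega)$, $E_\infty(u)\le\liminf_{n\to\infty}E_n(v_n)$; (ii) there is a sequence $v_n\to u$ in $L^1(\Omega)$ with $E_\infty(u)\ge\limsup_{n\to\infty}E_n(v_n)$. -/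

import Mathlib

open Set Filter Topology MeasureTheory
open scoped ENNReal ContDiff

noncomputable section

namespace OrliczGamma

/-- The Euclidean space `ℝ^d`. -/
abbrev Eucl (d : ℕ) : Type := EuclideanSpace ℝ (Fin d)

/-- `Ω` is a bounded smooth domain of `ℝ^d`: a nonempty, connected, bounded open set which near every
boundary point is a sublevel set `{ρ < 0}` of a smooth function `ρ` with nonvanishing differential,
so that `∂Ω` is a smooth hypersurface with `Ω` locally on one side of it. -/
structure IsBoundedSmoothDomain {d : ℕ} (Ω : Set (Eucl d)) : Prop where
  isOpen : IsOpen Ω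
  isConnected : IsConnected Ω
  isBounded : Bornology.IsBounded Ω
  smooth_boundary : ∀ x₀ ∈ frontier Ω, ∃ (U : Set (Eucl d)) (ρ : Eucl d → ℝ),
    IsOpen U ∧ x₀ ∈ U ∧ ContDiffOn ℝ ∞ ρ U ∧ fderiv ℝ ρ x₀ ≠ 0 ∧ Ω ∩ U = {x ∈ U | ρ x < 0}

/-- The standing conditions on a density `φ` with exponents `p⁻`, `p⁺`:
`φ ∈ C(Ω̄ × [0,∞)) ∩ C¹(Ω × (0,∞))`, `φ > 0` on `Ω × (0,∞)` and
`0 < p⁻ - 1 ≤ s ∂ₛφ(x,s) / φ(x,s) ≤ p⁺ - 1` on `Ω × (0,∞)`. -/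
structure IsDensity {d : ℕ} (Ω : Set (Eucl d)) (φ : Eucl d → ℝ → ℝ) (pm pp : ℝ) : Prop where
  continuousOn : ContinuousOn (fun z : Eucl d × ℝ => φ z.1 z.2) (closure Ω ×ˢ Ici 0)
  contDiffOn : ContDiffOn ℝ 1 (fun z : Eucl d × ℝ => φ z.1 z.2) (Ω ×ˢ Ioi 0)
  pos : ∀ x ∈ Ω, ∀ s : ℝ, 0 < s → 0 < φ x s
  pm_pos : 0 < pm - 1
  lower : ∀ x ∈ Ω, ∀ s : ℝ, 0 < s → pm - 1 ≤ s * deriv (φ x) s / φ x s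
  upper : ∀ x ∈ Ω, ∀ s : ℝ, 0 < s → s * deriv (φ x) s / φ x s ≤ pp - 1

/-- The generalized `Φ`-function `Φ(x,s) = ∫₀ˢ φ(x,t) dt` generated by `φ`. -/
def genPhi {d : ℕ} (φ : Eucl d → ℝ → ℝ) (x : Eucl d) (s : ℝ) : ℝ :=
  ∫ t in (0 : ℝ)..s, φ x t

/-- The modular `ϱ_Φ(u) = ∫_Ω Φ(x,|u(x)|) dx ∈ [0,∞]`. -/
def modular {d : ℕ} (Ω : Set (Eucl d)) (Φ : Eucl d → ℝ → ℝ) (u : Eucl d → ℝ) : ℝ≥0∞ :=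
  ∫⁻ x in Ω, ENNReal.ofReal (Φ x |u x|)

/-- Membership in the generalized Orlicz space `L^Φ(Ω)`:
`u ∈ L¹(Ω)` and `ϱ_Φ(l u) → 0` as `l → 0`. -/
def MemOrlicz {d : ℕ} (Ω : Set (Eucl d)) (Φ : Eucl d → ℝ → ℝ) (u : Eucl d → ℝ) : Prop :=
  Integrable u (volume.restrict Ω) ∧
    Tendsto (fun l : ℝ => modular Ω Φ (fun x => l * u x)) (𝓝[≠] 0) (𝓝 0)

/-- `G` is a weak gradient of `u` on `Ω`: both are locally integrable on `Ω` and
`∫_Ω u ∂ᵢψ = - ∫_Ω Gᵢ ψ` for all `i` and all test functions `ψ ∈ C_c^∞(Ω)`. -/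
structure IsWeakGradient {d : ℕ} (Ω : Set (Eucl d)) (u : Eucl d → ℝ) (G : Eucl d → Eucl d) :
    Prop where
  locallyIntegrableOn : LocallyIntegrableOn u Ω
  locallyIntegrableOn_grad : LocallyIntegrableOn G Ω
  integral_eq : ∀ ψ : Eucl d → ℝ, ContDiff ℝ ∞ ψ → HasCompactSupport ψ → tsupport ψ ⊆ Ω →
    ∀ i : Fin d, ∫ x in Ω, u x * fderiv ℝ ψ x (EuclideanSpace.single i 1) =
      - ∫ x in Ω, G x i * ψ x

open Classical in
/-- The weak gradient `∇u` of `u` on `Ω` (unique up to null sets, see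
`IsWeakGradient.ae_eq_weakGrad`); the value `0` is used when there is none. -/
def weakGrad {d : ℕ} (Ω : Set (Eucl d)) (u : Eucl d → ℝ) : Eucl d → Eucl d :=
  if h : ∃ G, IsWeakGradient Ω u G then h.choose else 0

theorem isWeakGradient_weakGrad {d : ℕ} {Ω : Set (Eucl d)} {u : Eucl d → ℝ}
    (h : ∃ G, IsWeakGradient Ω u G) : IsWeakGradient Ω u (weakGrad Ω u) := by
  unfold weakGrad
  rw [dif_pos h]
  exact h.choose_spec

theorem locallyIntegrableOn_coord {d : ℕ} {Ω : Set (Eucl d)} {G : Eucl d → Eucl d}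
    (h : LocallyIntegrableOn G Ω) (i : Fin d) : LocallyIntegrableOn (fun x => G x i) Ω := by
  intro x hx
  obtain ⟨s, hs, hi⟩ := h x hx
  exact ⟨s, hs, (EuclideanSpace.proj (𝕜 := ℝ) i).integrable_comp hi⟩

/-- Weak gradients agree almost everywhere, so `weakGrad` is well defined. -/
theorem IsWeakGradient.ae_eq_weakGrad {d : ℕ} {Ω : Set (Eucl d)} (hΩ : IsOpen Ω)
    {u : Eucl d → ℝ} {G : Eucl d → Eucl d} (h : IsWeakGradient Ω u G) :
    ∀ᵐ x ∂(volume.restrict Ω), G x = weakGrad Ω u x := by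
  have h' := isWeakGradient_weakGrad ⟨G, h⟩
  set H := weakGrad Ω u
  have key : ∀ i : Fin d, ∀ᵐ x ∂(volume : Measure (Eucl d)), x ∈ Ω → G x i - H x i = 0 := by
    intro i
    have l1 := locallyIntegrableOn_coord h.locallyIntegrableOn_grad i
    have l2 := locallyIntegrableOn_coord h'.locallyIntegrableOn_grad i
    refine hΩ.ae_eq_zero_of_integral_contDiff_smul_eq_zero (l1.sub l2) ?_
    intro ψ hψ hc hs
    have e : ∀ K : Eucl d → ℝ, LocallyIntegrableOn K Ω →
        Integrable (fun x => ψ x • K x) := by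
      intro K hK
      have hi : IntegrableOn K (tsupport ψ) := hK.integrableOn_compact_subset hs hc
      have hm : IntegrableOn (fun x => ψ x • K x) (tsupport ψ) :=
        hi.continuousOn_smul hψ.continuous.continuousOn hc
      refine (integrableOn_iff_integrable_of_support_subset ?_).1 hm
      intro x hx
      by_contra hx'
      exact hx (by simp [image_eq_zero_of_notMem_tsupport hx'])
    have r : ∀ K : Eucl d → ℝ, ∫ x in Ω, K x * ψ x = ∫ x, ψ x • K x := by
      intro K
      rw [setIntegral_eq_integral_of_forall_compl_eq_zero]
      · simp only [smul_eq_mul, mul_comm]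
      · intro x hx
        rw [image_eq_zero_of_notMem_tsupport (fun hx' => hx (hs hx')), mul_zero]
    have e1 := h.integral_eq ψ hψ hc hs i
    have e2 := h'.integral_eq ψ hψ hc hs i
    rw [r] at e1 e2
    have e3 : (∫ x, ψ x • G x i) = ∫ x, ψ x • H x i := by linarith
    simp only [smul_sub]
    rw [integral_sub (e _ l1) (e _ l2), e3, sub_self]
  rw [ae_restrict_iff' hΩ.measurableSet]
  filter_upwards [ae_all_iff.2 key] with x hx hxΩ
  ext i
  exact sub_eq_zero.1 (hx i hxΩ)

/-- Membership in the Sobolev-Orlicz space `W^{1,Φ}(Ω)`: `u` and its weak derivatives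
`∂₁u, …, ∂_d u` belong to `L^Φ(Ω)`. -/
def MemSobolevOrlicz {d : ℕ} (Ω : Set (Eucl d)) (Φ : Eucl d → ℝ → ℝ) (u : Eucl d → ℝ) : Prop :=
  MemOrlicz Ω Φ u ∧ ∃ G, IsWeakGradient Ω u G ∧ ∀ i : Fin d, MemOrlicz Ω Φ (fun x => G x i)

/-- Membership in `W^{1,∞}(Ω)`: `u` and its weak derivatives belong to `L^∞(Ω)`. -/
def MemW1Infty {d : ℕ} (Ω : Set (Eucl d)) (u : Eucl d → ℝ) : Prop :=
  MemLp u ∞ (volume.restrict Ω) ∧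
    ∃ G, IsWeakGradient Ω u G ∧ ∀ i : Fin d, MemLp (fun x => G x i) ∞ (volume.restrict Ω)

/-- The space `L¹(Ω)`. -/
abbrev L1 {d : ℕ} (Ω : Set (Eucl d)) : Type := Lp ℝ 1 (volume.restrict Ω)

open Classical in
/-- The extended natural energy on `L¹(Ω)`: `E(u) = ∫_Ω Φ(x,|∇u|) / φ(x,1) dx` if
`u ∈ W^{1,Φ}(Ω)`, and `E(u) = ∞` otherwise. -/
def energy {d : ℕ} (Ω : Set (Eucl d)) (φ : Eucl d → ℝ → ℝ) (u : L1 Ω) : ℝ≥0∞ :=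
  if MemSobolevOrlicz Ω (genPhi φ) u then
    ∫⁻ x in Ω, ENNReal.ofReal (genPhi φ x ‖weakGrad Ω u x‖ / φ x 1)
  else ∞

open Classical in
/-- The limit functional on `L¹(Ω)`: `E_∞(u) = 0` if `u ∈ W^{1,∞}(Ω)` and
`‖∇u‖_{L^∞(Ω)} ≤ 1`, and `E_∞(u) = ∞` otherwise. -/
def energyInfty {d : ℕ} (Ω : Set (Eucl d)) (u : L1 Ω) : ℝ≥0∞ :=
  if MemW1Infty Ω u ∧ eLpNorm (weakGrad Ω u) ∞ (volume.restrict Ω) ≤ 1 then 0 else ∞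

/-- `Γ`-convergence `Γ(X)-lim Jₙ = J` of functionals on a metric space `X`, with values in a
complete lattice of extended numbers such as `[0,∞]`. -/
structure GammaConverges {X β : Type*} [MetricSpace X] [CompleteLattice β]
    (J : ℕ → X → β) (Jlim : X → β) : Prop where
  lower_bound : ∀ (u : X) (v : ℕ → X), Tendsto v atTop (𝓝 u) →
    Jlim u ≤ liminf (fun n => J n (v n)) atTop
  recovery : ∀ u : X, ∃ v : ℕ → X, Tendsto v atTop (𝓝 u) ∧
    limsup (fun n => J n (v n)) atTop ≤ Jlim u

end OrliczGamma

end

namespace OrliczGamma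

/-! ### Growth of the densities and energy of gradients bounded by one -/

section Density

variable {d : ℕ} {Ω : Set (Eucl d)} {φ : Eucl d → ℝ → ℝ} {pm pp : ℝ}

/-! The lower growth condition makes `φ(x,s) / s^(pm - 1)` nondecreasing in `s`, so for large `pm`
the density normalized by `φ(x,1)` is tiny below `s = 1` and huge above it.

Recovery: if `|∇u| ≤ 1`, integrating `φ(x,t) ≤ t^(pm - 1) φ(x,1)` over `[0,1]` bounds the energy of
`u` by `|Ω| / pm`, so the constant sequence works (`IsDensity.energy_le`).

Lower bound: for `1 < m < M` and `s ≥ M` the normalized energy density is at least `K s`, where `K =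
(1 - m/M) m^(pm - 1) → ∞`. An energy bound `c` thus leaves at most `c / K` for the integral of
`|∇vₙ|` over `{|∇vₙ| ≥ M}`. Testing with `ψ`, passing to the limit and letting `M ↓ 1` gives `|∫ u
∂ₑψ| ≤ ‖e‖ ∫ |ψ|` (`hasUnitBoundedGradient_of_liminf_lt_top`); no weak compactness of the gradients
is needed.

This distributional bound yields `u ∈ W^{1,∞}` with `|∇u| ≤ 1`
(`HasUnitBoundedGradient.memW1Infty`): limits of mollifications give a representative nonexpansive
along segments, its a.e. gradient is the weak gradient, and the smooth boundary makes it bounded. -/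

theorem IsDensity.differentiableAt (hΩ : IsOpen Ω) (h : IsDensity Ω φ pm pp) {x : Eucl d}
    (hx : x ∈ Ω) {s : ℝ} (hs : 0 < s) : DifferentiableAt ℝ (φ x) s := by
  have h1 : DifferentiableAt ℝ (fun z : Eucl d × ℝ => φ z.1 z.2) (x, s) :=
    (h.contDiffOn.differentiableOn one_ne_zero).differentiableAt
      ((hΩ.prod isOpen_Ioi).mem_nhds ⟨hx, hs⟩)
  exact h1.comp (f := fun t : ℝ => (x, t)) s
    ((differentiableAt_const x).prodMk differentiableAt_id)

theorem IsDensity.continuousOn_right (h : IsDensity Ω φ pm pp) {x : Eucl d} (hx : x ∈ closure Ω) :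
    ContinuousOn (φ x) (Ici 0) :=
  h.continuousOn.comp (f := fun t : ℝ => (x, t)) (by fun_prop) fun _ ht => ⟨hx, ht⟩

theorem IsDensity.intervalIntegrable (h : IsDensity Ω φ pm pp) {x : Eucl d} (hx : x ∈ closure Ω)
    {a b : ℝ} (ha : 0 ≤ a) (hb : 0 ≤ b) : IntervalIntegrable (φ x) volume a b := by
  refine ((h.continuousOn_right hx).mono ?_).intervalIntegrable
  intro t ht
  exact (le_min ha hb).trans ht.1

/-- The growth condition says that `s ↦ φ(x,s) / s^(p⁻ - 1)` is nondecreasing. -/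
theorem IsDensity.monotoneOn_div_rpow (hΩ : IsOpen Ω) (h : IsDensity Ω φ pm pp) {x : Eucl d}
    (hx : x ∈ Ω) : MonotoneOn (fun s => φ x s * s ^ (-(pm - 1))) (Ioi 0) := by
  have hd : ∀ s ∈ Ioi (0 : ℝ), HasDerivAt (fun s => φ x s * s ^ (-(pm - 1)))
      (deriv (φ x) s * s ^ (-(pm - 1)) + φ x s * (-(pm - 1) * s ^ (-(pm - 1) - 1))) s :=
    fun s hs => (h.differentiableAt hΩ hx hs).hasDerivAt.mul
      (Real.hasDerivAt_rpow_const (Or.inl (ne_of_gt hs)))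
  refine monotoneOn_of_deriv_nonneg (convex_Ioi 0)
    (fun s hs => (hd s hs).continuousAt.continuousWithinAt) ?_ ?_
  · rw [interior_Ioi]
    exact fun s hs => (hd s hs).differentiableAt.differentiableWithinAt
  · rw [interior_Ioi]
    intro s hs
    rw [(hd s hs).deriv]
    have hs' : (0 : ℝ) < s := hs
    -- Factoring out `s^(-(pm - 1) - 1)` leaves `s φ' - (pm - 1) φ`, which is nonnegative by the
    -- growth condition.
    have e : s ^ (-(pm - 1)) = s * s ^ (-(pm - 1) - 1) := by
      rw [Real.rpow_sub_one hs'.ne']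
      field_simp
    have hl := (le_div_iff₀ (h.pos x hx s hs)).1 (h.lower x hx s hs)
    have hp : 0 ≤ s ^ (-(pm - 1) - 1) := (Real.rpow_pos_of_pos hs' _).le
    rw [e]
    nlinarith [mul_nonneg (sub_nonneg.2 hl) hp]

/-- The source of all growth estimates: `a = 1` gives growth above `1`, `b = 1` gives decay below
`1`. -/
theorem IsDensity.rpow_mul_le (hΩ : IsOpen Ω) (h : IsDensity Ω φ pm pp) {x : Eucl d}
    (hx : x ∈ Ω) {a b : ℝ} (ha : 0 < a) (hab : a ≤ b) :
    (b / a) ^ (pm - 1) * φ x a ≤ φ x b := by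
  have hb := ha.trans_le hab
  have hm := h.monotoneOn_div_rpow hΩ hx ha hb hab
  simp only [Real.rpow_neg ha.le, Real.rpow_neg hb.le] at hm
  rw [← div_eq_mul_inv, ← div_eq_mul_inv,
    le_div_iff₀ (Real.rpow_pos_of_pos hb _)] at hm
  rw [Real.div_rpow hb.le ha.le]
  calc _ = φ x a / a ^ (pm - 1) * b ^ (pm - 1) := by ring
    _ ≤ _ := hm

theorem IsDensity.monotoneOn (hΩ : IsOpen Ω) (h : IsDensity Ω φ pm pp) {x : Eucl d}
    (hx : x ∈ Ω) : MonotoneOn (φ x) (Ioi 0) := by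
  intro a ha b hb hab
  refine le_trans ?_ (h.rpow_mul_le hΩ hx ha hab)
  exact le_mul_of_one_le_left (h.pos x hx a ha).le
    (Real.one_le_rpow ((one_le_div (mem_Ioi.1 ha)).2 hab) h.pm_pos.le)

theorem IsDensity.nonneg (h : IsDensity Ω φ pm pp) {x : Eucl d} (hx : x ∈ Ω) {s : ℝ}
    (hs : 0 ≤ s) : 0 ≤ φ x s := by
  have : closure (Ioi (0 : ℝ)) ⊆ Ici 0 := by rw [closure_Ioi]
  have hc : ContinuousOn (φ x) (closure (Ioi 0)) :=
    (h.continuousOn_right (subset_closure hx)).mono this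
  have := le_on_closure (s := Ioi (0 : ℝ)) (f := fun _ => (0 : ℝ)) (g := φ x)
    (fun t ht => (h.pos x hx t ht).le) continuousOn_const hc
  exact this (by rw [closure_Ioi]; exact hs)

theorem IsDensity.genPhi_mono (h : IsDensity Ω φ pm pp) {x : Eucl d} (hx : x ∈ Ω) {a b : ℝ}
    (ha : 0 ≤ a) (hab : a ≤ b) : genPhi φ x a ≤ genPhi φ x b := by
  have hx' := subset_closure hx
  unfold genPhi
  rw [← intervalIntegral.integral_add_adjacent_intervals
    (h.intervalIntegrable hx' le_rfl ha) (h.intervalIntegrable hx' ha (ha.trans hab))]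
  have := intervalIntegral.integral_nonneg (μ := volume) hab
    (fun t ht => h.nonneg hx (ha.trans ht.1))
  linarith

theorem IsDensity.genPhi_one_le (hΩ : IsOpen Ω) (h : IsDensity Ω φ pm pp) {x : Eucl d}
    (hx : x ∈ Ω) : genPhi φ x 1 ≤ φ x 1 / pm := by
  have hp := h.pm_pos
  have hi : IntervalIntegrable (fun t : ℝ => t ^ (pm - 1) * φ x 1) volume 0 1 :=
    (intervalIntegral.intervalIntegrable_rpow' (by linarith)).mul_const _
  have := intervalIntegral.integral_mono_on_of_le_Ioo (zero_le_one' ℝ)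
    (h.intervalIntegrable (subset_closure hx) le_rfl zero_le_one) hi ?_
  · unfold genPhi
    refine this.trans (le_of_eq ?_)
    rw [intervalIntegral.integral_mul_const, integral_rpow (Or.inl (by linarith))]
    have : pm ≠ 0 := by linarith
    simp [this]
    ring
  · intro t ht
    have := h.rpow_mul_le hΩ hx ht.1 ht.2.le
    rw [one_div, Real.inv_rpow ht.1.le, inv_mul_le_iff₀ (Real.rpow_pos_of_pos ht.1 _)] at this
    exact this

/-- For `s ≥ M > 1` the normalized energy density dominates a large multiple of `s`. -/
theorem IsDensity.le_genPhi_div (hΩ : IsOpen Ω) (h : IsDensity Ω φ pm pp) {x : Eucl d}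
    (hx : x ∈ Ω) {m M s : ℝ} (hm : 1 ≤ m) (hmM : m ≤ M) (hs : M ≤ s) :
    (1 - m / M) * m ^ (pm - 1) * s ≤ genPhi φ x s / φ x 1 := by
  have hx' := subset_closure hx
  have hm0 : 0 < m := by linarith
  have hM0 : 0 < M := by linarith
  have h1 := h.pos x hx 1 one_pos
  rw [le_div_iff₀ h1]
  have hphi : m ^ (pm - 1) * φ x 1 ≤ φ x m := by
    simpa using h.rpow_mul_le hΩ hx one_pos hm
  -- The integral over `[0,m]` is discarded; on `[m,s]` monotonicity bounds the integrand below by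
  -- `φ x m`.
  have e1 : (s - m) * φ x m ≤ genPhi φ x s := by
    unfold genPhi
    rw [← intervalIntegral.integral_add_adjacent_intervals
      (h.intervalIntegrable hx' le_rfl hm0.le)
      (h.intervalIntegrable hx' hm0.le (hm0.le.trans (hmM.trans hs)))]
    have a1 := intervalIntegral.integral_nonneg (μ := volume) hm0.le
      (fun t ht => h.nonneg hx ht.1)
    have a2 := intervalIntegral.integral_mono_on (μ := volume) (hmM.trans hs)
      (intervalIntegrable_const (c := φ x m))
      (h.intervalIntegrable hx' hm0.le (hm0.le.trans (hmM.trans hs)))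
      (fun t ht => h.monotoneOn hΩ hx hm0 (hm0.trans_le ht.1) ht.1)
    simp only [intervalIntegral.integral_const, smul_eq_mul] at a2
    linarith
  have e2 : (1 - m / M) * s ≤ s - m := by
    have : m ≤ m / M * s := by
      rw [div_mul_eq_mul_div, le_div_iff₀ hM0]
      exact mul_le_mul_of_nonneg_left hs hm0.le
    linarith
  have hsm : 0 ≤ s - m := by linarith
  calc _ = ((1 - m / M) * s) * (m ^ (pm - 1) * φ x 1) := by ring
    _ ≤ (s - m) * (m ^ (pm - 1) * φ x 1) :=
      mul_le_mul_of_nonneg_right e2 (mul_nonneg (Real.rpow_nonneg hm0.le _) h1.le)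
    _ ≤ (s - m) * φ x m := mul_le_mul_of_nonneg_left hphi hsm
    _ ≤ _ := e1

/-- Bounded functions belong to the generalized Orlicz space. -/
theorem IsDensity.memOrlicz_of_memLp_top (hΩ : IsBoundedSmoothDomain Ω)
    (h : IsDensity Ω φ pm pp) {u : Eucl d → ℝ} (hu : MemLp u ∞ (volume.restrict Ω)) :
    MemOrlicz Ω (genPhi φ) u := by
  have hfin : IsFiniteMeasure (volume.restrict Ω) :=
    ⟨by simpa using hΩ.isBounded.measure_lt_top⟩
  refine ⟨(hu.mono_exponent le_top).integrable le_rfl, ?_⟩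
  obtain ⟨R, hR0, hR⟩ : ∃ R : ℝ, 0 ≤ R ∧ ∀ᵐ x ∂(volume.restrict Ω), |u x| ≤ R := by
    refine ⟨(eLpNorm u ∞ (volume.restrict Ω)).toReal, ENNReal.toReal_nonneg, ?_⟩
    have hne := hu.2.ne
    rw [eLpNorm_exponent_top] at hne ⊢
    filter_upwards [ae_le_eLpNormEssSup (f := u) (μ := volume.restrict Ω)] with x hx
    have := ENNReal.toReal_mono hne hx
    simpa using this
  -- Continuity up to the boundary bounds `φ` on the compact set `closure Ω × [0,R]`; `|l| ≤ 1`
  -- keeps `|l u|` in `[0,R]`.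
  obtain ⟨B, hB⟩ := ((hΩ.isBounded.isCompact_closure.prod
    (isCompact_Icc (a := (0 : ℝ)) (b := R))).exists_bound_of_continuousOn
    (h.continuousOn.mono (prod_mono_right Icc_subset_Ici_self)))
  have hmeas : ∀ᵐ x ∂(volume.restrict Ω), x ∈ Ω := ae_restrict_mem hΩ.isOpen.measurableSet
  have hle : ∀ l : ℝ, |l| ≤ 1 → modular Ω (genPhi φ) (fun x => l * u x) ≤
      ENNReal.ofReal (B * (|l| * R)) * volume Ω := by
    intro l hl
    unfold modular
    calc _ ≤ ∫⁻ _ in Ω, ENNReal.ofReal (B * (|l| * R)) := by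
          refine lintegral_mono_ae ?_
          filter_upwards [hR, hmeas] with x hx hxΩ
          refine ENNReal.ofReal_le_ofReal ?_
          have a1 : |l * u x| ≤ |l| * R := by
            rw [abs_mul]; exact mul_le_mul_of_nonneg_left hx (abs_nonneg _)
          refine (h.genPhi_mono hxΩ (abs_nonneg _) a1).trans ?_
          have a2 : 0 ≤ |l| * R := mul_nonneg (abs_nonneg _) hR0
          have := intervalIntegral.norm_integral_le_of_norm_le_const (f := φ x) (C := B)
            (a := 0) (b := |l| * R) (fun t ht => by
              rw [uIoc_of_le a2] at ht
              refine hB (x, t) ⟨subset_closure hxΩ, ht.1.le, ht.2.trans ?_⟩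
              exact mul_le_of_le_one_left hR0 hl)
          rw [sub_zero, abs_of_nonneg a2] at this
          exact (le_abs_self _).trans this
      _ = _ := by simp
  have hlim : Tendsto (fun l : ℝ => ENNReal.ofReal (B * (|l| * R)) * volume Ω) (𝓝[≠] 0) (𝓝 0) := by
    have c : Continuous fun l : ℝ => ENNReal.ofReal (B * (|l| * R)) :=
      ENNReal.continuous_ofReal.comp (by fun_prop)
    have := ENNReal.Tendsto.mul_const (b := volume Ω) (c.tendsto 0)
      (Or.inr hΩ.isBounded.measure_lt_top.ne)
    simp only [abs_zero, zero_mul, mul_zero, ENNReal.ofReal_zero] at this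
    exact this.mono_left nhdsWithin_le_nhds
  refine tendsto_of_tendsto_of_tendsto_of_le_of_le' tendsto_const_nhds hlim
    (Eventually.of_forall fun _ => zero_le) ?_
  refine nhdsWithin_le_nhds ?_
  filter_upwards [Metric.closedBall_mem_nhds (0 : ℝ) one_pos] with l hl
  exact hle l (by simpa using hl)

/-- Energy of a function with gradient bounded by one. -/
theorem IsDensity.energy_le (hΩ : IsBoundedSmoothDomain Ω) (h : IsDensity Ω φ pm pp) {u : L1 Ω}
    (hu : MemW1Infty Ω u) (hg : eLpNorm (weakGrad Ω u) ∞ (volume.restrict Ω) ≤ 1) :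
    energy Ω φ u ≤ ENNReal.ofReal (1 / pm) * volume Ω := by
  obtain ⟨hu1, G, hG, hGi⟩ := hu
  have hmem : MemSobolevOrlicz Ω (genPhi φ) u :=
    ⟨h.memOrlicz_of_memLp_top hΩ hu1, G, hG, fun i => h.memOrlicz_of_memLp_top hΩ (hGi i)⟩
  unfold energy
  rw [if_pos hmem]
  calc _ ≤ ∫⁻ _ in Ω, ENNReal.ofReal (1 / pm) := by
        refine lintegral_mono_ae ?_
        rw [eLpNorm_exponent_top] at hg
        filter_upwards [ae_le_eLpNormEssSup (f := weakGrad Ω u) (μ := volume.restrict Ω),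
          ae_restrict_mem hΩ.isOpen.measurableSet] with x hx hxΩ
        refine ENNReal.ofReal_le_ofReal ?_
        have hx1 : ‖weakGrad Ω u x‖ ≤ 1 := by
          have := ENNReal.toReal_mono ENNReal.one_ne_top (hx.trans hg)
          simpa using this
        have h1 := h.pos x hxΩ 1 one_pos
        rw [div_le_iff₀ h1]
        refine (h.genPhi_mono hxΩ (norm_nonneg _) hx1).trans
          ((h.genPhi_one_le hΩ.isOpen hxΩ).trans (le_of_eq (by ring)))
    _ = _ := by simp

end Density

end OrliczGamma

namespace OrliczGamma

/-! ### From the distributional bound to a nonexpansive representative -/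

section Mollification

open scoped Convolution

variable {d : ℕ} {Ω : Set (Eucl d)} {u : Eucl d → ℝ}

/-- The distributional gradient of `u` on `Ω` is bounded by one in every direction. -/
def HasUnitBoundedGradient (Ω : Set (Eucl d)) (u : Eucl d → ℝ) : Prop :=
  ∀ ψ : Eucl d → ℝ, ContDiff ℝ ∞ ψ → HasCompactSupport ψ → tsupport ψ ⊆ Ω →
    ∀ e : Eucl d, |∫ x in Ω, u x * fderiv ℝ ψ x e| ≤ ‖e‖ * ∫ x, |ψ x|

/-- A bump function supported in the closed ball of radius `2 / (k + 1)`. -/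
noncomputable def shrinkingBump (d k : ℕ) : ContDiffBump (0 : Eucl d) where
  rIn := 1 / ((k : ℝ) + 1)
  rOut := 2 * (1 / ((k : ℝ) + 1))
  rIn_pos := by positivity
  rIn_lt_rOut := by
    have : 0 < 1 / ((k : ℝ) + 1) := by positivity
    linarith

theorem tendsto_shrinkingBump_rOut (d : ℕ) :
    Tendsto (fun k => (shrinkingBump d k).rOut) atTop (𝓝 0) := by
  have := (tendsto_one_div_add_atTop_nhds_zero_nat (𝕜 := ℝ)).const_mul 2
  simpa [shrinkingBump] using this

/-- The mollifications of `u`, extended by zero outside `Ω`. -/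
noncomputable def mollification (Ω : Set (Eucl d)) (u : Eucl d → ℝ) (k : ℕ) : Eucl d → ℝ :=
  (shrinkingBump d k).normed volume ⋆[ContinuousLinearMap.lsmul ℝ ℝ, volume] (Ω.indicator u)

/-- Up to sign, the derivative of the mollification at `x` along `e` is `u` tested against `∂ₑψ`
with `ψ(y) = η(x - y)`. The ball condition makes `ψ` admissible, and `∫ |ψ| = 1`. -/
theorem HasUnitBoundedGradient.mollification (hΩ : IsOpen Ω)
    (hu : Integrable u (volume.restrict Ω)) (hb : HasUnitBoundedGradient Ω u) {k : ℕ} {x : Eucl d}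
    (hx : Metric.closedBall x (shrinkingBump d k).rOut ⊆ Ω) :
    DifferentiableAt ℝ (mollification Ω u k) x ∧ ‖fderiv ℝ (mollification Ω u k) x‖ ≤ 1 := by
  set b := shrinkingBump d k
  set η : Eucl d → ℝ := b.normed volume with hη
  have hηc : HasCompactSupport η := b.hasCompactSupport_normed
  have hηs : ContDiff ℝ ∞ η := b.contDiff_normed
  have hη1 : ContDiff ℝ 1 η := b.contDiff_normed
  have hg : LocallyIntegrable (Ω.indicator u) volume :=
    ((integrable_indicator_iff hΩ.measurableSet).2 hu).locallyIntegrable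
  have hder := hηc.hasFDerivAt_convolution_left (ContinuousLinearMap.lsmul ℝ ℝ) hη1 hg x
  refine ⟨hder.differentiableAt, ?_⟩
  have hder' : HasFDerivAt (OrliczGamma.mollification Ω u k) _ x := hder
  rw [hder'.fderiv]
  refine ContinuousLinearMap.opNorm_le_bound _ zero_le_one fun e => ?_
  have hexi : Integrable (fun t => ((ContinuousLinearMap.lsmul ℝ ℝ).precompL (Eucl d))
      (fderiv ℝ η t) (Ω.indicator u (x - t))) volume :=
    (hηc.fderiv ℝ).convolutionExists_left _ (hη1.continuous_fderiv one_ne_zero) hg x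
  rw [convolution, ContinuousLinearMap.integral_apply hexi]
  set ψ : Eucl d → ℝ := fun y => η (x - y) with hψ
  have hψd : ∀ y, fderiv ℝ ψ y e = - fderiv ℝ η (x - y) e := by
    intro y
    have h1 : HasFDerivAt (fun y : Eucl d => x - y) (-ContinuousLinearMap.id ℝ (Eucl d)) y :=
      (hasFDerivAt_id y).const_sub x
    have h2 := ((hη1.differentiable one_ne_zero) (x - y)).hasFDerivAt.comp y h1
    have h3 : HasFDerivAt ψ _ y := h2
    rw [h3.fderiv]
    simp
  have hψts : tsupport ψ ⊆ Metric.closedBall x b.rOut := by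
    refine closure_minimal ?_ Metric.isClosed_closedBall
    intro y hy
    have hy' : x - y ∈ Function.support η := hy
    rw [hη, b.support_normed_eq, mem_ball_zero_iff] at hy'
    rw [mem_closedBall_iff_norm, norm_sub_rev]
    exact hy'.le
  have hψc : HasCompactSupport ψ :=
    (isCompact_closedBall x b.rOut).of_isClosed_subset (isClosed_tsupport ψ) hψts
  have key := hb ψ (hηs.comp (by fun_prop)) hψc (hψts.trans hx) e
  have eq1 : (∫ t, (((ContinuousLinearMap.lsmul ℝ ℝ).precompL (Eucl d))
      (fderiv ℝ η t) (Ω.indicator u (x - t))) e) = - ∫ y in Ω, u y * fderiv ℝ ψ y e := by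
    rw [← integral_sub_left_eq_self _ volume x, ← integral_indicator hΩ.measurableSet,
      ← integral_neg]
    refine integral_congr_ae (Eventually.of_forall fun y => ?_)
    by_cases hy : y ∈ Ω
    · simp [ContinuousLinearMap.precompL_apply, hψd, hy, mul_comm]
    · simp [hy]
  have eq2 : (∫ y, |ψ y|) = 1 := by
    have : ∀ y, |ψ y| = η (x - y) := fun y => abs_of_nonneg (b.nonneg_normed _)
    simp only [this]
    rw [integral_sub_left_eq_self (fun y => η y) volume x]
    exact b.integral_normed
  rw [eq1, norm_neg, Real.norm_eq_abs, one_mul]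
  rwa [eq2, mul_one] at key

/-- A compact segment has a closed `δ`-neighbourhood in `Ω`; once the kernel radius is at most `δ`,
the mean value inequality applies. -/
theorem HasUnitBoundedGradient.eventually_mollification_le (hΩ : IsOpen Ω)
    (hu : Integrable u (volume.restrict Ω)) (hb : HasUnitBoundedGradient Ω u) {x y : Eucl d}
    (hxy : segment ℝ x y ⊆ Ω) :
    ∀ᶠ k in atTop, |OrliczGamma.mollification Ω u k y - OrliczGamma.mollification Ω u k x|
      ≤ ‖y - x‖ := by
  have hK : IsCompact (segment ℝ x y) := by
    rw [segment_eq_image_lineMap]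
    exact isCompact_Icc.image (by fun_prop)
  obtain ⟨δ, hδ, hsub⟩ := hK.exists_cthickening_subset_open hΩ hxy
  filter_upwards [(tendsto_shrinkingBump_rOut d).eventually_le_const hδ] with k hk
  have h : ∀ z ∈ segment ℝ x y, Metric.closedBall z (shrinkingBump d k).rOut ⊆ Ω :=
    fun z hz => (Metric.closedBall_subset_closedBall hk).trans
      ((Metric.closedBall_subset_cthickening hz δ).trans hsub)
  have := (convex_segment x y).norm_image_sub_le_of_norm_fderiv_le
    (fun z hz => (hb.mollification hΩ hu (h z hz)).1)
    (fun z hz => (hb.mollification hΩ hu (h z hz)).2)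
    (left_mem_segment ℝ x y) (right_mem_segment ℝ x y)
  simpa using this

/-- A function with distributional gradient bounded by one has a representative which is
nonexpansive along all segments in `Ω`. -/
theorem HasUnitBoundedGradient.exists_representative (hΩ : IsOpen Ω)
    (hu : Integrable u (volume.restrict Ω)) (hb : HasUnitBoundedGradient Ω u) :
    ∃ w : Eucl d → ℝ, (∀ᵐ x ∂(volume.restrict Ω), u x = w x) ∧
      ∀ x y, segment ℝ x y ⊆ Ω → |w y - w x| ≤ ‖y - x‖ := by
  have hg : LocallyIntegrable (Ω.indicator u) volume :=
    ((integrable_indicator_iff hΩ.measurableSet).2 hu).locallyIntegrable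
  have hae : ∀ᵐ x ∂(volume : Measure (Eucl d)),
      Tendsto (fun k => OrliczGamma.mollification Ω u k x) atTop (𝓝 (Ω.indicator u x)) :=
    ContDiffBump.ae_convolution_tendsto_right_of_locallyIntegrable (K := 2)
      (tendsto_shrinkingBump_rOut d) (Eventually.of_forall fun k => le_rfl) hg
  have hdense := Measure.dense_of_ae hae
  -- Almost everywhere convergence gives convergence on a dense set. The eventual nonexpansiveness
  -- carries the Cauchy property from a nearby point `s` to `x`, at a cost of `ε / 4` for each of
  -- three differences.
  have hlim : ∀ x ∈ Ω, ∃ l, Tendsto (fun k => OrliczGamma.mollification Ω u k x) atTop (𝓝 l) := by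
    intro x hx
    refine cauchySeq_tendsto_of_complete (Metric.cauchySeq_iff.2 fun ε hε => ?_)
    obtain ⟨r, hr, hball⟩ := Metric.isOpen_iff.1 hΩ x hx
    obtain ⟨s, hs, hs'⟩ := Metric.dense_iff.1 hdense x (min r (ε / 4)) (by positivity)
    rw [Metric.mem_ball, lt_min_iff] at hs
    have hseg : segment ℝ s x ⊆ Ω :=
      ((convex_ball x r).segment_subset hs.1 (Metric.mem_ball_self hr)).trans hball
    have hs'' : CauchySeq fun k => OrliczGamma.mollification Ω u k s := Tendsto.cauchySeq hs'
    obtain ⟨N₁, hN₁⟩ := eventually_atTop.1 (hb.eventually_mollification_le hΩ hu hseg)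
    obtain ⟨N₂, hN₂⟩ := Metric.cauchySeq_iff.1 hs'' (ε / 4) (by positivity)
    refine ⟨max N₁ N₂, fun m hm n hn => ?_⟩
    have b1 := hN₁ m ((le_max_left _ _).trans hm)
    have b2 := hN₁ n ((le_max_left _ _).trans hn)
    have b3 := hN₂ m ((le_max_right _ _).trans hm) n ((le_max_right _ _).trans hn)
    rw [← dist_eq_norm, dist_comm x s] at b1 b2
    rw [Real.dist_eq, abs_lt] at b3 ⊢
    rw [abs_le] at b1 b2
    constructor <;> linarith [hs.2]
  choose! w hw using hlim
  refine ⟨w, ?_, fun x y hxy => ?_⟩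
  · rw [ae_restrict_iff' hΩ.measurableSet]
    filter_upwards [hae] with x hx hxΩ
    rw [indicator_of_mem hxΩ] at hx
    exact tendsto_nhds_unique hx (hw x hxΩ)
  · exact le_of_tendsto ((hw y (hxy (right_mem_segment ℝ x y))).sub
      (hw x (hxy (left_mem_segment ℝ x y)))).abs (hb.eventually_mollification_le hΩ hu hxy)

end Mollification

end OrliczGamma

namespace OrliczGamma

/-! ### Nonexpansive functions: weak gradient and boundedness -/

section Nonexpansive

variable {d : ℕ} {Ω : Set (Eucl d)} {w : Eucl d → ℝ}

/-- `w` is nonexpansive along every segment contained in `Ω`. -/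
def SegmentNonexpansive (Ω : Set (Eucl d)) (w : Eucl d → ℝ) : Prop :=
  ∀ x y, segment ℝ x y ⊆ Ω → |w y - w x| ≤ ‖y - x‖

theorem SegmentNonexpansive.lipschitzOnWith (hw : SegmentNonexpansive Ω w) {s : Set (Eucl d)}
    (hs : Convex ℝ s) (hsΩ : s ⊆ Ω) : LipschitzOnWith 1 w s := by
  refine LipschitzOnWith.of_dist_le_mul fun x hx y hy => ?_
  rw [Real.dist_eq, dist_eq_norm, NNReal.coe_one, one_mul]
  exact hw y x ((hs.segment_subset hy hx).trans hsΩ)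

theorem SegmentNonexpansive.continuousOn (hΩ : IsOpen Ω) (hw : SegmentNonexpansive Ω w) :
    ContinuousOn w Ω := by
  intro x hx
  obtain ⟨r, hr, hball⟩ := Metric.isOpen_iff.1 hΩ x hx
  exact ((hw.lipschitzOnWith (convex_ball x r) hball).continuousOn.continuousAt
    (Metric.ball_mem_nhds x hr)).continuousWithinAt

theorem norm_gradient (w : Eucl d → ℝ) (x : Eucl d) : ‖gradient w x‖ = ‖fderiv ℝ w x‖ := by
  simp [gradient]

theorem gradient_apply (w : Eucl d → ℝ) (x : Eucl d) (i : Fin d) :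
    gradient w x i = fderiv ℝ w x (EuclideanSpace.single i 1) := by
  rw [← inner_gradient_left, EuclideanSpace.inner_single_right]
  simp

theorem measurable_gradient (w : Eucl d → ℝ) : Measurable (gradient w) :=
  (LinearIsometryEquiv.continuous _).measurable.comp (measurable_fderiv ℝ w)

/-- No differentiability is needed: `gradient w` is `0` where it fails. -/
theorem SegmentNonexpansive.norm_gradient_le (hΩ : IsOpen Ω) (hw : SegmentNonexpansive Ω w)
    {x : Eucl d} (hx : x ∈ Ω) : ‖gradient w x‖ ≤ 1 := by
  obtain ⟨r, hr, hball⟩ := Metric.isOpen_iff.1 hΩ x hx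
  rw [norm_gradient]
  refine norm_fderiv_le_of_lip' ℝ zero_le_one ?_
  filter_upwards [Metric.ball_mem_nhds x hr] with y hy
  rw [Real.norm_eq_abs, one_mul]
  exact hw x y (((convex_ball x r).segment_subset (Metric.mem_ball_self hr) hy).trans hball)

/-- On a compact neighbourhood of the support of `ψ`, `w` is Lipschitz and agrees with a globally
Lipschitz `g`. Rademacher's theorem and integration by parts apply to `g`, whose derivatives on the
support are those of `w`. -/
theorem SegmentNonexpansive.isWeakGradient (hΩ : IsOpen Ω) (hb : Bornology.IsBounded Ω)
    (hw : SegmentNonexpansive Ω w) : IsWeakGradient Ω w (gradient w) := by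
  have hfin : IsFiniteMeasure (volume.restrict Ω) := ⟨by simpa using hb.measure_lt_top⟩
  have hgi : IntegrableOn (gradient w) Ω := by
    refine Integrable.of_bound (measurable_gradient w).aestronglyMeasurable 1 ?_
    filter_upwards [ae_restrict_mem hΩ.measurableSet] with x hx
    exact hw.norm_gradient_le hΩ hx
  refine ⟨(hw.continuousOn hΩ).locallyIntegrableOn hΩ.measurableSet,
    hgi.locallyIntegrableOn, fun ψ hψ hψc hψΩ i => ?_⟩
  set e : Eucl d := EuclideanSpace.single i 1
  obtain ⟨δ, hδ, hK⟩ := IsCompact.exists_cthickening_subset_open hψc hΩ hψΩ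
  have hKc : IsCompact (Metric.cthickening δ (tsupport ψ)) := IsCompact.cthickening hψc
  have hloc : LocallyLipschitzOn (Metric.cthickening δ (tsupport ψ)) w := by
    intro x hx
    obtain ⟨r, hr, hball⟩ := Metric.isOpen_iff.1 hΩ x (hK hx)
    exact ⟨1, Metric.ball x r, nhdsWithin_le_nhds (Metric.ball_mem_nhds x hr),
      hw.lipschitzOnWith (convex_ball x r) hball⟩
  obtain ⟨C, hC⟩ := hloc.exists_lipschitzOnWith_of_compact hKc
  obtain ⟨g, hg, hwg⟩ := hC.extend_real
  have hev : ∀ x ∈ tsupport ψ, w =ᶠ[𝓝 x] g := fun x hx => by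
    filter_upwards [Metric.ball_mem_nhds x hδ] with y hy
    exact hwg (Metric.thickening_subset_cthickening _ _ (Metric.ball_subset_thickening hx δ hy))
  obtain ⟨D, hD⟩ := hψ.lipschitzWith_of_hasCompactSupport hψc (by simp)
  have key := hg.integral_lineDeriv_mul_eq (μ := volume) hD hψc e
  have e1 : ∫ x in Ω, w x * fderiv ℝ ψ x e = ∫ x, fderiv ℝ ψ x e * g x := by
    rw [setIntegral_eq_integral_of_forall_compl_eq_zero]
    · refine integral_congr_ae (Eventually.of_forall fun x => ?_)
      by_cases hx : x ∈ tsupport ψ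
      · simp [(hev x hx).eq_of_nhds, mul_comm]
      · simp [fderiv_of_notMem_tsupport ℝ hx]
    · intro x hx
      simp [fderiv_of_notMem_tsupport ℝ fun h => hx (hψΩ h)]
  have e2 : ∫ x in Ω, gradient w x i * ψ x = ∫ x, lineDeriv ℝ g x e * ψ x := by
    rw [setIntegral_eq_integral_of_forall_compl_eq_zero]
    · refine integral_congr_ae ?_
      filter_upwards [hg.ae_differentiableAt (μ := volume)] with x hxd
      by_cases hx : x ∈ tsupport ψ
      · simp [gradient_apply, (hev x hx).fderiv_eq, hxd.lineDeriv_eq_fderiv, e]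
      · simp [image_eq_zero_of_notMem_tsupport hx]
    · intro x hx
      simp [image_eq_zero_of_notMem_tsupport fun h => hx (hψΩ h)]
  rw [e1, e2, key, ← integral_neg]
  refine integral_congr_ae (Eventually.of_forall fun x => ?_)
  simp [((hψ.differentiable (by simp)) x).lineDeriv_eq_fderiv]

/-- Near a boundary point, a segment in a fixed direction leads from each point of a smooth domain
into a fixed compact subset of it. -/
theorem IsBoundedSmoothDomain.exists_segment_into_compact (hΩ : IsBoundedSmoothDomain Ω)
    {x₀ : Eucl d} (hx₀ : x₀ ∈ frontier Ω) :
    ∃ V ∈ 𝓝 x₀, ∃ v : Eucl d, ∃ K ⊆ Ω, IsCompact K ∧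
      ∀ x ∈ V ∩ Ω, segment ℝ x (x + v) ⊆ Ω ∧ x + v ∈ K := by
  obtain ⟨U, ρ, hU, hxU, hρ, hρ', hΩU⟩ := hΩ.smooth_boundary x₀ hx₀
  obtain ⟨v₀, hv₀⟩ : ∃ v, fderiv ℝ ρ x₀ v ≠ 0 := by
    by_contra! hcon
    exact hρ' (ContinuousLinearMap.ext hcon)
  set L := fderiv ℝ ρ x₀
  set v : Eucl d := (-(L v₀)⁻¹) • v₀
  have hLv : L v = -1 := by simp [v, hv₀]
  -- Strict differentiability makes the descent along `v` uniform in the starting point near `x₀`.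
  -- With `c ‖v‖ ≤ 1/2` it gives `ρ (x + t • v) ≤ ρ x - t + t/2 < -t/2`.
  have hstrict : HasStrictFDerivAt ρ L x₀ :=
    (hρ.contDiffAt (hU.mem_nhds hxU)).hasStrictFDerivAt (by simp)
  set c : NNReal := ⟨1 / (2 * (‖v‖ + 1)), by positivity⟩
  have hc : (c : ℝ) * ‖v‖ ≤ 1 / 2 := by
    change 1 / (2 * (‖v‖ + 1)) * ‖v‖ ≤ 1 / 2
    rw [div_mul_eq_mul_div, div_le_div_iff₀ (by positivity) two_pos]
    linarith [norm_nonneg v]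
  have hc0 : 0 < c := by
    change (0 : ℝ) < 1 / (2 * (‖v‖ + 1))
    positivity
  obtain ⟨s, hs, happ⟩ := hstrict.approximates_deriv_on_nhds (Or.inr hc0)
  obtain ⟨r, hr, hball⟩ := Metric.mem_nhds_iff.1 (inter_mem hs (hU.mem_nhds hxU))
  -- This step length keeps segments starting within `r/4` of `x₀` inside the closed ball of radius
  -- `r/2`.
  set τ : ℝ := r / (4 * (‖v‖ + 1))
  have hτ : 0 < τ := by positivity
  have hτv : τ * ‖v‖ ≤ r / 4 := by
    simp only [τ]
    rw [div_mul_eq_mul_div, div_le_div_iff₀ (by positivity) (by positivity)]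
    nlinarith [norm_nonneg v]
  have hdec : ∀ x ∈ Metric.ball x₀ (r / 4) ∩ Ω, ∀ t ∈ Icc 0 τ,
      x + t • v ∈ Metric.closedBall x₀ (r / 2) ∧ ρ (x + t • v) < - (t / 2) := by
    intro x hx t ht
    have htv : ‖t • v‖ ≤ r / 4 := by
      rw [norm_smul, Real.norm_of_nonneg ht.1]
      exact (mul_le_mul_of_nonneg_right ht.2 (norm_nonneg v)).trans hτv
    have hxr : ‖x - x₀‖ < r / 4 := mem_ball_iff_norm.1 hx.1
    have hmem : x + t • v ∈ Metric.closedBall x₀ (r / 2) := by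
      rw [mem_closedBall_iff_norm, add_sub_right_comm]
      exact (norm_add_le _ _).trans (by linarith)
    refine ⟨hmem, ?_⟩
    have m1 : x + t • v ∈ Metric.ball x₀ r :=
      Metric.closedBall_subset_ball (by linarith) hmem
    have m2 : x ∈ Metric.ball x₀ r := Metric.ball_subset_ball (by linarith) hx.1
    have ha := happ (x + t • v) (hball m1).1 x (hball m2).1
    rw [add_sub_cancel_left, map_smul, hLv, smul_eq_mul, norm_smul,
      Real.norm_of_nonneg ht.1, Real.norm_eq_abs] at ha
    have hρx : ρ x < 0 := by
      have : x ∈ Ω ∩ U := ⟨hx.2, (hball m2).2⟩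
      rw [hΩU] at this
      exact this.2
    have hct : (c : ℝ) * (t * ‖v‖) ≤ t / 2 := by nlinarith [ht.1]
    have := (abs_le.1 ha).2
    linarith
  have hsub : Metric.closedBall x₀ (r / 2) ⊆ U := fun z hz =>
    (hball (Metric.closedBall_subset_ball (by linarith) hz)).2
  have hΩmem : ∀ z ∈ Metric.closedBall x₀ (r / 2), ρ z < 0 → z ∈ Ω := by
    intro z hz hz'
    have : z ∈ Ω ∩ U := by rw [hΩU]; exact ⟨hsub hz, hz'⟩
    exact this.1
  refine ⟨Metric.ball x₀ (r / 4), Metric.ball_mem_nhds _ (by positivity), τ • v,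
    {z ∈ Metric.closedBall x₀ (r / 2) | ρ z ≤ - (τ / 2)}, ?_, ?_, ?_⟩
  · exact fun z hz => hΩmem z hz.1 (hz.2.trans_lt (by linarith))
  · refine (isCompact_closedBall x₀ (r / 2)).of_isClosed_subset ?_ fun z hz => hz.1
    exact (hρ.continuousOn.mono hsub).preimage_isClosed_of_isClosed
      Metric.isClosed_closedBall isClosed_Iic
  · intro x hx
    refine ⟨?_, ⟨(hdec x hx τ ⟨hτ.le, le_rfl⟩).1, (hdec x hx τ ⟨hτ.le, le_rfl⟩).2.le⟩⟩
    rw [segment_eq_image']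
    rintro _ ⟨θ, hθ, rfl⟩
    simp only [add_sub_cancel_left, smul_smul]
    have := hdec x hx (θ * τ) ⟨mul_nonneg hθ.1 hτ.le, mul_le_of_le_one_left hτ.le hθ.2⟩
    exact hΩmem _ this.1 (this.2.trans_le (by nlinarith [mul_nonneg hθ.1 hτ.le]))

/-- Compactness of `closure Ω` reduces this to local bounds. Near the boundary, a segment of fixed
length `‖v‖` leads into a compact set where the continuous `w` is bounded. Boundary regularity
enters only here. -/
theorem SegmentNonexpansive.exists_bound (hΩ : IsBoundedSmoothDomain Ω)
    (hw : SegmentNonexpansive Ω w) : ∃ R : ℝ, ∀ x ∈ Ω, |w x| ≤ R := by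
  have hloc : ∀ x₀ ∈ closure Ω, ∃ t ∈ 𝓝[closure Ω] x₀, ∃ R : ℝ, ∀ x ∈ t ∩ Ω, |w x| ≤ R := by
    intro x₀ hx₀
    by_cases hmem : x₀ ∈ Ω
    · obtain ⟨r, hr, hball⟩ := Metric.isOpen_iff.1 hΩ.isOpen x₀ hmem
      refine ⟨_, nhdsWithin_le_nhds (Metric.ball_mem_nhds x₀ hr), |w x₀| + r, fun x hx => ?_⟩
      have h1 := hw x₀ x
        (((convex_ball x₀ r).segment_subset (Metric.mem_ball_self hr) hx.1).trans hball)
      have h2 := mem_ball_iff_norm.1 hx.1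
      have h3 := abs_sub_abs_le_abs_sub (w x) (w x₀)
      linarith
    · have hfr : x₀ ∈ frontier Ω := by
        rw [hΩ.isOpen.frontier_eq]; exact ⟨hx₀, hmem⟩
      obtain ⟨V, hV, v, K, hKΩ, hK, hseg⟩ := hΩ.exists_segment_into_compact hfr
      obtain ⟨B, hB⟩ := hK.exists_bound_of_continuousOn ((hw.continuousOn hΩ.isOpen).mono hKΩ)
      refine ⟨V, nhdsWithin_le_nhds hV, B + ‖v‖, fun x hx => ?_⟩
      obtain ⟨h1, h2⟩ := hseg x hx
      have h3 := hw _ _ h1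
      rw [add_sub_cancel_left] at h3
      have h4 := hB _ h2
      rw [Real.norm_eq_abs] at h4
      have h5 := abs_sub_abs_le_abs_sub (w x) (w (x + v))
      rw [abs_sub_comm] at h5
      linarith
  have := hΩ.isBounded.isCompact_closure.induction_on
    (p := fun t => ∃ R : ℝ, ∀ x ∈ t ∩ Ω, |w x| ≤ R) ⟨0, by simp⟩
    (fun s t hst ⟨R, hR⟩ => ⟨R, fun x hx => hR x ⟨hst hx.1, hx.2⟩⟩)
    (fun s t ⟨R, hR⟩ ⟨R', hR'⟩ => ⟨max R R', fun x hx => hx.1.elim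
      (fun h => (hR x ⟨h, hx.2⟩).trans (le_max_left _ _))
      (fun h => (hR' x ⟨h, hx.2⟩).trans (le_max_right _ _))⟩)
    hloc
  obtain ⟨R, hR⟩ := this
  exact ⟨R, fun x hx => hR x ⟨subset_closure hx, hx⟩⟩

theorem HasUnitBoundedGradient.memW1Infty (hΩ : IsBoundedSmoothDomain Ω) {u : Eucl d → ℝ}
    (hu : Integrable u (volume.restrict Ω)) (hb : HasUnitBoundedGradient Ω u) :
    MemW1Infty Ω u ∧ eLpNorm (weakGrad Ω u) ∞ (volume.restrict Ω) ≤ 1 := by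
  obtain ⟨w, huw, hw⟩ := hb.exists_representative hΩ.isOpen hu
  have hw : SegmentNonexpansive Ω w := hw
  have hmem : ∀ᵐ x ∂(volume.restrict Ω), x ∈ Ω := ae_restrict_mem hΩ.isOpen.measurableSet
  have hG : IsWeakGradient Ω u (gradient w) := by
    have h := hw.isWeakGradient hΩ.isOpen hΩ.isBounded
    refine ⟨IntegrableOn.locallyIntegrableOn hu, h.locallyIntegrableOn_grad,
      fun ψ h1 h2 h3 i => ?_⟩
    rw [← h.integral_eq ψ h1 h2 h3 i]
    refine integral_congr_ae ?_
    filter_upwards [huw] with x hx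
    rw [hx]
  obtain ⟨R, hR⟩ := hw.exists_bound hΩ
  refine ⟨⟨memLp_top_of_bound hu.1 R ?_, gradient w, hG, fun i => memLp_top_of_bound
    ?_ 1 ?_⟩, ?_⟩
  · filter_upwards [huw, hmem] with x hx hxΩ
    rw [hx]
    exact hR x hxΩ
  · exact ((EuclideanSpace.proj (𝕜 := ℝ) i).continuous.measurable.comp
      (measurable_gradient w)).aestronglyMeasurable
  · filter_upwards [hmem] with x hxΩ
    exact (PiLp.norm_apply_le (gradient w x) i).trans (hw.norm_gradient_le hΩ.isOpen hxΩ)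
  · have : ∀ᵐ x ∂(volume.restrict Ω), ‖weakGrad Ω u x‖ ≤ 1 := by
      filter_upwards [hG.ae_eq_weakGrad hΩ.isOpen, hmem] with x hx hxΩ
      rw [← hx]
      exact hw.norm_gradient_le hΩ.isOpen hxΩ
    rw [eLpNorm_exponent_top]
    simpa using eLpNormEssSup_le_of_ae_bound this

end Nonexpansive

end OrliczGamma

namespace OrliczGamma

/-! ### Passing to the limit under an energy bound -/

section LowerBound

variable {d : ℕ} {Ω : Set (Eucl d)}

theorem eucl_eq_sum_single (e : Eucl d) : e = ∑ i, e i • EuclideanSpace.single i (1 : ℝ) := by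
  ext j
  simp [Finset.sum_apply, Pi.single_apply]

theorem fderiv_apply_eq_sum (ψ : Eucl d → ℝ) (x e : Eucl d) :
    fderiv ℝ ψ x e = ∑ i, e i * fderiv ℝ ψ x (EuclideanSpace.single i 1) := by
  conv_lhs => rw [eucl_eq_sum_single e]
  simp [map_sum]

theorem exists_bound_fderiv_apply {ψ : Eucl d → ℝ} (hψ : ContDiff ℝ ∞ ψ)
    (hc : HasCompactSupport ψ) (e : Eucl d) :
    ∃ B : ℝ, 0 ≤ B ∧ ∀ x, ‖fderiv ℝ ψ x e‖ ≤ B := by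
  obtain ⟨B, hB⟩ := (hc.fderiv_apply (𝕜 := ℝ) e).exists_bound_of_continuous
    ((hψ.continuous_fderiv (by simp)).clm_apply continuous_const)
  exact ⟨B, (norm_nonneg _).trans (hB 0), hB⟩

theorem integrable_mul_fderiv_apply {u ψ : Eucl d → ℝ} (hu : Integrable u (volume.restrict Ω))
    (hψ : ContDiff ℝ ∞ ψ) (hc : HasCompactSupport ψ) (e : Eucl d) :
    Integrable (fun x => u x * fderiv ℝ ψ x e) (volume.restrict Ω) := by
  obtain ⟨B, -, hB⟩ := exists_bound_fderiv_apply hψ hc e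
  exact hu.mul_bdd (c := B)
    ((hψ.continuous_fderiv (by simp)).clm_apply continuous_const).aestronglyMeasurable
    (Eventually.of_forall hB)

/-- Testing in an arbitrary direction `e` allows the estimate `|⟨G, e⟩| ≤ ‖G‖ ‖e‖`, whose constant
`1` coordinatewise bounds would lose. -/
theorem IsWeakGradient.integral_fderiv_apply {u : Eucl d → ℝ} {G : Eucl d → Eucl d}
    (hu : Integrable u (volume.restrict Ω)) (hG : IsWeakGradient Ω u G) {ψ : Eucl d → ℝ}
    (hψ : ContDiff ℝ ∞ ψ) (hc : HasCompactSupport ψ) (hs : tsupport ψ ⊆ Ω) (e : Eucl d) :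
    ∫ x in Ω, u x * fderiv ℝ ψ x e = - ∫ x in Ω, inner ℝ (G x) e * ψ x := by
  have hGi : ∀ i : Fin d, Integrable (fun x => G x i * ψ x) (volume.restrict Ω) := by
    intro i
    have l := locallyIntegrableOn_coord hG.locallyIntegrableOn_grad i
    have hi : IntegrableOn (fun x => G x i) (tsupport ψ) := l.integrableOn_compact_subset hs hc
    have hm : IntegrableOn (fun x => G x i * ψ x) (tsupport ψ) :=
      hi.mul_continuousOn hψ.continuous.continuousOn hc
    refine ((integrableOn_iff_integrable_of_support_subset ?_).1 hm).integrableOn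
    intro x hx
    by_contra hx'
    exact hx (by simp [image_eq_zero_of_notMem_tsupport hx'])
  have e1 : ∀ x, u x * fderiv ℝ ψ x e =
      ∑ i, e i * (u x * fderiv ℝ ψ x (EuclideanSpace.single i 1)) := by
    intro x
    rw [fderiv_apply_eq_sum ψ x e, Finset.mul_sum]
    exact Finset.sum_congr rfl fun i _ => by ring
  have e2 : ∀ x, inner ℝ (G x) e * ψ x = ∑ i, e i * (G x i * ψ x) := by
    intro x
    rw [PiLp.inner_apply, Finset.sum_mul]
    exact Finset.sum_congr rfl fun i _ => by simp; ring
  simp only [e1, e2]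
  rw [integral_finsetSum _ fun i _ => (integrable_mul_fderiv_apply hu hψ hc _).const_mul _,
    integral_finsetSum _ fun i _ => (hGi i).const_mul _, ← Finset.sum_neg_distrib]
  refine Finset.sum_congr rfl fun i _ => ?_
  rw [integral_const_mul, integral_const_mul, hG.integral_eq ψ hψ hc hs i, mul_neg]

/-- An energy bound controls the distributional gradient up to a small error. -/
theorem IsDensity.abs_integral_fderiv_le (hΩ : IsOpen Ω) {φ : Eucl d → ℝ → ℝ} {pm pp : ℝ}
    (h : IsDensity Ω φ pm pp) {v : L1 Ω} {c : ℝ} (hc0 : 0 ≤ c)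
    (hv : energy Ω φ v ≤ ENNReal.ofReal c) {m M : ℝ} (hm : 1 ≤ m) (hmM : m < M)
    {ψ : Eucl d → ℝ} (hψ : ContDiff ℝ ∞ ψ) (hc : HasCompactSupport ψ) (hs : tsupport ψ ⊆ Ω)
    {P : ℝ} (hP : ∀ x, |ψ x| ≤ P) (e : Eucl d) :
    |∫ x in Ω, v x * fderiv ℝ ψ x e| ≤
      ‖e‖ * M * (∫ x, |ψ x|) + ‖e‖ * P * ((1 - m / M) * m ^ (pm - 1))⁻¹ * c := by
  set K := (1 - m / M) * m ^ (pm - 1)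
  have hM0 : 0 < M := by linarith
  have hP0 : 0 ≤ P := (abs_nonneg _).trans (hP 0)
  have hK : 0 < K := mul_pos (by rw [sub_pos, div_lt_one hM0]; exact hmM)
    (Real.rpow_pos_of_pos (by linarith) _)
  have hmem : MemSobolevOrlicz Ω (genPhi φ) v := by
    by_contra hcon
    unfold energy at hv
    rw [if_neg hcon] at hv
    exact absurd hv (not_le.2 ENNReal.ofReal_lt_top)
  have hen : ∫⁻ x in Ω, ENNReal.ofReal (genPhi φ x ‖weakGrad Ω v x‖ / φ x 1) ≤
      ENNReal.ofReal c := by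
    unfold energy at hv
    rwa [if_pos hmem] at hv
  obtain ⟨hv1, G, hG, -⟩ := hmem
  rw [(isWeakGradient_weakGrad ⟨G, hG⟩).integral_fderiv_apply hv1.1 hψ hc hs e, abs_neg,
    ← Real.norm_eq_abs]
  set H := weakGrad Ω v
  have hψi : Integrable (fun x => |ψ x|) := (hψ.continuous.integrable_of_hasCompactSupport hc).abs
  have hI : 0 ≤ ∫ x, |ψ x| := integral_nonneg fun x => abs_nonneg _
  have hpt : ∀ x ∈ Ω, ‖inner ℝ (H x) e * ψ x‖ₑ ≤ ENNReal.ofReal (‖e‖ * M * |ψ x|) +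
      ENNReal.ofReal (‖e‖ * P * K⁻¹) * ENNReal.ofReal (genPhi φ x ‖H x‖ / φ x 1) := by
    intro x hx
    have hq : 0 ≤ genPhi φ x ‖H x‖ / φ x 1 := by
      refine div_nonneg ?_ (h.pos x hx 1 one_pos).le
      have := h.genPhi_mono hx le_rfl (norm_nonneg (H x))
      simpa [genPhi] using this
    rw [← ENNReal.ofReal_mul (by positivity), ← ENNReal.ofReal_add (by positivity)
      (by positivity), ← ofReal_norm]
    refine ENNReal.ofReal_le_ofReal ?_
    rw [norm_mul, Real.norm_eq_abs (ψ x)]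
    have a1 : ‖inner ℝ (H x) e‖ * |ψ x| ≤ ‖H x‖ * ‖e‖ * |ψ x| :=
      mul_le_mul_of_nonneg_right (norm_inner_le_norm _ _) (abs_nonneg _)
    refine a1.trans ?_
    -- Gradients up to `M` give the main term; larger ones are absorbed by `K⁻¹` times the energy
    -- density.
    rcases le_total ‖H x‖ M with hHM | hHM
    · have a2 : ‖H x‖ * (‖e‖ * |ψ x|) ≤ M * (‖e‖ * |ψ x|) :=
        mul_le_mul_of_nonneg_right hHM (by positivity)
      have a3 : 0 ≤ ‖e‖ * P * K⁻¹ * (genPhi φ x ‖H x‖ / φ x 1) := by positivity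
      linarith
    · have a2 := h.le_genPhi_div hΩ hx hm hmM.le hHM
      have a3 : ‖H x‖ ≤ K⁻¹ * (genPhi φ x ‖H x‖ / φ x 1) := by
        rw [inv_mul_eq_div, le_div_iff₀ hK, mul_comm]
        exact a2
      have a4 : ‖H x‖ * ‖e‖ * |ψ x| ≤ K⁻¹ * (genPhi φ x ‖H x‖ / φ x 1) * ‖e‖ * P := by
        have := hP x
        gcongr
      have a5 : 0 ≤ ‖e‖ * M * |ψ x| := by positivity
      linarith
  have hle : ENNReal.ofReal ‖∫ x in Ω, inner ℝ (H x) e * ψ x‖ ≤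
      ENNReal.ofReal (‖e‖ * M * ∫ x, |ψ x|) +
        ENNReal.ofReal (‖e‖ * P * K⁻¹) * ENNReal.ofReal c := by
    rw [ofReal_norm]
    calc _ ≤ ∫⁻ x in Ω, ‖inner ℝ (H x) e * ψ x‖ₑ := enorm_integral_le_lintegral_enorm _
      _ ≤ ∫⁻ x in Ω, (ENNReal.ofReal (‖e‖ * M * |ψ x|) +
            ENNReal.ofReal (‖e‖ * P * K⁻¹) * ENNReal.ofReal (genPhi φ x ‖H x‖ / φ x 1)) :=
          setLIntegral_mono' hΩ.measurableSet hpt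
      _ = (∫⁻ x in Ω, ENNReal.ofReal (‖e‖ * M * |ψ x|)) + ENNReal.ofReal (‖e‖ * P * K⁻¹) *
            ∫⁻ x in Ω, ENNReal.ofReal (genPhi φ x ‖H x‖ / φ x 1) := by
          have hcont := hψ.continuous
          -- Only the first, continuous summand needs to be measurable; nothing is asked of the
          -- energy density.
          rw [lintegral_add_left, lintegral_const_mul' _ _ ENNReal.ofReal_ne_top]
          exact (ENNReal.continuous_ofReal.comp (by fun_prop)).measurable
      _ ≤ _ := by
          refine add_le_add ?_ (by gcongr)
          refine (setLIntegral_le_lintegral _ _).trans (le_of_eq ?_)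
          rw [← integral_const_mul, ofReal_integral_eq_lintegral_ofReal (hψi.const_mul _)
            (Eventually.of_forall fun x => by positivity)]
  rw [← ENNReal.ofReal_mul (by positivity), ← ENNReal.ofReal_add (by positivity)
    (by positivity)] at hle
  exact (ENNReal.ofReal_le_ofReal_iff (by positivity)).1 hle

theorem tendsto_integral_mul_fderiv {v : ℕ → L1 Ω} {u : L1 Ω} (hv : Tendsto v atTop (𝓝 u))
    {ψ : Eucl d → ℝ} (hψ : ContDiff ℝ ∞ ψ) (hc : HasCompactSupport ψ) (e : Eucl d) :
    Tendsto (fun n => ∫ x in Ω, v n x * fderiv ℝ ψ x e) atTop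
      (𝓝 (∫ x in Ω, u x * fderiv ℝ ψ x e)) := by
  have hi : ∀ f : L1 Ω, Integrable (fun x => f x * fderiv ℝ ψ x e) (volume.restrict Ω) :=
    fun f => integrable_mul_fderiv_apply (L1.integrable_coeFn f) hψ hc e
  refine tendsto_integral_of_L1' _ (hi u).1 (Eventually.of_forall fun n => hi (v n)) ?_
  obtain ⟨B, hB0, hB⟩ := exists_bound_fderiv_apply hψ hc e
  have h0 := ENNReal.Tendsto.const_mul (a := ENNReal.ofReal B)
    ((Lp.tendsto_Lp_iff_tendsto_eLpNorm' v u).1 hv) (Or.inr ENNReal.ofReal_ne_top)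
  rw [mul_zero] at h0
  refine tendsto_of_tendsto_of_tendsto_of_le_of_le tendsto_const_nhds h0
    (fun _ => zero_le) fun n => ?_
  refine eLpNorm_le_mul_eLpNorm_of_ae_le_mul (Eventually.of_forall fun x => ?_) 1
  simp only [Pi.sub_apply]
  rw [← sub_mul, norm_mul, mul_comm]
  exact mul_le_mul_of_nonneg_right (hB x) (norm_nonneg _)

theorem hasUnitBoundedGradient_of_liminf_lt_top (hΩ : IsOpen Ω) {φ : ℕ → Eucl d → ℝ → ℝ}
    {pm pp : ℕ → ℝ} (hφ : ∀ n, IsDensity Ω (φ n) (pm n) (pp n)) (hpm : Tendsto pm atTop atTop)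
    {v : ℕ → L1 Ω} {u : L1 Ω} (hv : Tendsto v atTop (𝓝 u))
    (hfin : liminf (fun n => energy Ω (φ n) (v n)) atTop < ⊤) : HasUnitBoundedGradient Ω u := by
  obtain ⟨c, hc, hc'⟩ := exists_between hfin
  -- A finite liminf bounds the energy only for infinitely many `n`. This suffices, since both sides
  -- of the inequality in `key` arise as limits of full sequences.
  have hfreq : ∃ᶠ n in atTop, energy Ω (φ n) (v n) ≤ ENNReal.ofReal c.toReal := by
    rw [ENNReal.ofReal_toReal hc'.ne]
    exact (frequently_lt_of_liminf_lt (by isBoundedDefault) hc).mono fun _ h => h.le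
  intro ψ hψ hψc hs e
  obtain ⟨P, hP⟩ := hψc.exists_bound_of_continuous hψ.continuous
  have hlim := (tendsto_integral_mul_fderiv hv hψ hψc e).abs
  have key : ∀ M : ℝ, 1 < M →
      |∫ x in Ω, u x * fderiv ℝ ψ x e| ≤ ‖e‖ * M * ∫ x, |ψ x| := by
    intro M hM
    -- Any `m` strictly between `1` and `M` would do: `m > 1` drives `K` to infinity and `m < M`
    -- keeps it positive.
    set m := (1 + M) / 2 with hm
    have hm1 : 1 < m := by rw [hm]; linarith
    have hmM : m < M := by rw [hm]; linarith
    have hK : Tendsto (fun n => (1 - m / M) * m ^ (pm n - 1)) atTop atTop := by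
      refine Tendsto.const_mul_atTop (by rw [sub_pos, div_lt_one (by linarith)]; exact hmM) ?_
      exact (tendsto_rpow_atTop_of_base_gt_one m hm1).comp
        (tendsto_atTop_add_const_right _ (-1) hpm)
    have hR : Tendsto (fun n => ‖e‖ * M * (∫ x, |ψ x|) +
        ‖e‖ * P * ((1 - m / M) * m ^ (pm n - 1))⁻¹ * c.toReal) atTop
        (𝓝 (‖e‖ * M * ∫ x, |ψ x|)) := by
      simpa using ((hK.inv_tendsto_atTop.const_mul (‖e‖ * P)).mul_const c.toReal).const_add
        (‖e‖ * M * ∫ x, |ψ x|)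
    exact le_of_tendsto_of_tendsto_of_frequently hlim hR (hfreq.mono fun n hn =>
      (hφ n).abs_integral_fderiv_le hΩ ENNReal.toReal_nonneg hn hm1.le hmM hψ hψc hs hP e)
  have hcont : Tendsto (fun M : ℝ => ‖e‖ * M * ∫ x, |ψ x|) (𝓝[>] 1)
      (𝓝 (‖e‖ * 1 * ∫ x, |ψ x|)) :=
    (by fun_prop : Continuous fun M : ℝ => ‖e‖ * M * ∫ x, |ψ x|).continuousWithinAt
  rw [mul_one] at hcont
  exact ge_of_tendsto hcont (by filter_upwards [self_mem_nhdsWithin] with M hM using key M hM)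

end LowerBound

end OrliczGamma

/-! ### The Γ-limit -/

theorem mainTheorem4 {d : ℕ} (Ω : Set (OrliczGamma.Eucl d))
    (hΩ : OrliczGamma.IsBoundedSmoothDomain Ω)
    (φ : ℕ → OrliczGamma.Eucl d → ℝ → ℝ) (pm pp : ℕ → ℝ)
    (hφ : ∀ n, OrliczGamma.IsDensity Ω (φ n) (pm n) (pp n))
    (hpm : Filter.Tendsto pm Filter.atTop Filter.atTop)
    (μ : ℝ) (hμ : 1 < μ) (hpp : ∀ n, pp n ≤ μ * pm n) :
    OrliczGamma.GammaConverges (fun n => OrliczGamma.energy Ω (φ n))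
      (OrliczGamma.energyInfty Ω) := by
  refine ⟨fun u v hv => ?_, fun u => ⟨fun _ => u, tendsto_const_nhds, ?_⟩⟩
  · rcases eq_top_or_lt_top
      (liminf (fun n => OrliczGamma.energy Ω (φ n) (v n)) atTop) with htop | hfin
    · simp only [htop, le_top]
    · have hb := OrliczGamma.hasUnitBoundedGradient_of_liminf_lt_top hΩ.isOpen hφ hpm hv hfin
      have h0 : OrliczGamma.energyInfty Ω u = 0 :=
        if_pos (hb.memW1Infty hΩ (L1.integrable_coeFn u))
      rw [h0]
      exact zero_le
  · by_cases hu : OrliczGamma.MemW1Infty Ω u ∧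
        eLpNorm (OrliczGamma.weakGrad Ω u) ⊤ (volume.restrict Ω) ≤ 1
    · have h0 : OrliczGamma.energyInfty Ω u = 0 := if_pos hu
      have hlim : Tendsto (fun n => ENNReal.ofReal (1 / pm n) * volume Ω) atTop (𝓝 0) := by
        have h1 := ENNReal.tendsto_ofReal hpm.inv_tendsto_atTop
        have h2 := ENNReal.Tendsto.mul_const (b := volume Ω) h1
          (Or.inr hΩ.isBounded.measure_lt_top.ne)
        simpa [one_div] using h2
      rw [h0, ← hlim.limsup_eq]
      exact limsup_le_limsup (Eventually.of_forall fun n => (hφ n).energy_le hΩ hu.1 hu.2)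
    · have h0 : OrliczGamma.energyInfty Ω u = ⊤ := if_neg hu
      rw [h0]
      exact le_top
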